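/- Let $N\in\mathbb{N}$ and let $X$ be an $\mathbb{R}^N$-valued random variable whose distribution $P_X$ is absolutely continuous w.r.t. the Lebesgue measure $\mu^N$ and concentrated on a set $\mathcal{X}\subseteq\mathbb{R}^N$. Let $g$ be a piecewise bijective function on $\mathcal{X}$: $\mathcal{X}$ is the disjoint union of at most countably many Borel sets $\mathcal{X}_i$; for every $i$ the restriction $g_i=g|_{\mathcal{X}_i}$ is a bijection onto its image $\mathcal{Y}_i\subseteq\mathbb{R}^N$ and is differentiable at every point of $\mathcal{X}_i$ (relative to $\mathcal{X}_i$); and, writing $J_g(x)$ for a Jacobian matrix at $x$ of the $g_i$ with $x\in\mathcal{X}_i$, $\det J_g(x)\neq 0$ for $P_X$-almost every $x$. Let $Y=g(X)$. All logarithms are to base $2$. Let $h(X)=-\int f_X\log f_X\,d\mu^N$ denote the differential entropy, $f_X$ being the density of $X$. Let $H(X|Y)=\int H(X|Y=y)\,dP_Y(y)$ denote the conditional entropy, where $H(X|Y=y)\in[0,\infty]$ is the entropy of the conditional distribution of $X$ given $Y=y$, i.e., the supremum of the entropies of its finite measurable quantizations. Then $P_Y\ll\mu^N$, and, whenever $h(X)$,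 $h(Y)$ and $\mathrm{E}[\log|\det J_g(X)|]$ exist in $[-\infty,\infty]$ and $h(X)-h(Y)+\mathrm{E}[\log|\det J_g(X)|]$ is not of the form $\infty-\infty$, the information loss $L(X\to Y)=H(X|Y)\in[0,\infty]$ is $$L(X\to Y)=h(X)-h(Y)+\mathrm{E}\big[\log|\det J_g(X)|\big].$$ Under the same conditions, with $\hat X_n=\lfloor 2^nX\rfloor/2^n$ (floor taken element-wise) and $I$ the mutual information, this number is also $\lim_{n\to\infty}\big(I(\hat X_n;X)-I(\hat X_n;Y)\big)$, provided that $I(\hat X_n;X)<\infty$ for all $n$. -/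

import Mathlib

open MeasureTheory ProbabilityTheory Filter Topology
open scoped ENNReal

/-- `ℝ^N`, with its Borel sets and its Lebesgue measure `volume`. -/
abbrev RSpace (N : ℕ) : Type := EuclideanSpace ℝ (Fin N)

/-- The integral of `f` exists in the extended sense: its positive part and its negative part are
not both of infinite integral. -/
def QuasiIntegrable {α : Type*} [MeasurableSpace α] (f : α → ℝ) (μ : Measure α) : Prop :=
  AEMeasurable f μ ∧
    ((∫⁻ x, ENNReal.ofReal (f x) ∂μ) ≠ ⊤ ∨ (∫⁻ x, ENNReal.ofReal (-f x) ∂μ) ≠ ⊤)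

/-- The integral of `f` with values in `[-∞, ∞]`, meaningful if `QuasiIntegrable f μ`. -/
noncomputable def extIntegral {α : Type*} [MeasurableSpace α] (f : α → ℝ) (μ : Measure α) :
    EReal :=
  ((∫⁻ x, ENNReal.ofReal (f x) ∂μ : ℝ≥0∞) : EReal) -
    ((∫⁻ x, ENNReal.ofReal (-f x) ∂μ : ℝ≥0∞) : EReal)

/-- The integrand `-f log₂ f` of the differential entropy, `f` being the Lebesgue density of `μ`
(with `0 log₂ 0 = 0`). -/
noncomputable def diffEntropyIntegrand {N : ℕ} (μ : Measure (RSpace N)) (x : RSpace N) : ℝ :=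
  -((μ.rnDeriv volume x).toReal * Real.logb 2 (μ.rnDeriv volume x).toReal)

/-- The differential entropy in bits of an absolutely continuous distribution `μ`. -/
noncomputable def diffEntropy {N : ℕ} (μ : Measure (RSpace N)) : EReal :=
  extIntegral (diffEntropyIntegrand μ) volume

/-- The entropy in bits of a distribution on an arbitrary measurable space: the supremum of the
entropies of its finite measurable quantizations. -/
noncomputable def entropy {α : Type*} [MeasurableSpace α] (μ : Measure α) : ℝ≥0∞ :=
  ⨆ (k : ℕ) (q : α → Fin k) (_ : Measurable q),
    ∑ j : Fin k, ENNReal.ofReal (-(μ.real (q ⁻¹' {j}) * Real.logb 2 (μ.real (q ⁻¹' {j}))))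

/-- The conditional entropy `H(X|Y) = ∫ H(X|Y=y) dP_Y(y)` in bits, where `H(X|Y=y)` is the entropy
of the regular conditional distribution of `X` given `Y = y`. -/
noncomputable def condEntropy {Ω α β : Type*} [MeasurableSpace Ω] [MeasurableSpace α]
    [StandardBorelSpace α] [Nonempty α] [MeasurableSpace β]
    (X : Ω → α) (Y : Ω → β) (P : Measure Ω) [IsFiniteMeasure P] : ℝ≥0∞ :=
  ∫⁻ y, entropy (condDistrib X Y P y) ∂(P.map Y)

/-- The mutual information `I(U;V)` in bits: the Kullback-Leibler divergence of the joint
distribution from the product of the marginals (`klDiv` is measured in nats). -/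
noncomputable def mutualInfo {Ω α β : Type*} [MeasurableSpace Ω] [MeasurableSpace α]
    [MeasurableSpace β] (U : Ω → α) (V : Ω → β) (P : Measure Ω) : ℝ≥0∞ :=
  InformationTheory.klDiv (P.map fun ω => (U ω, V ω)) ((P.map U).prod (P.map V)) /
    ENNReal.ofReal (Real.log 2)

/-- Uniform quantization with hypercubes of side length `2^{-n}`: `⌊2^n x⌋ / 2^n`, element-wise. -/
noncomputable def quantize {N : ℕ} (n : ℕ) (x : RSpace N) : RSpace N :=
  WithLp.toLp 2 fun j => (⌊(2 : ℝ) ^ n * x j⌋ : ℝ) / (2 : ℝ) ^ n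

/-- `g` is a piecewise bijective function on `𝒳 ⊆ ℝ^N` for an input with distribution `μ`:
the Borel sets `piece i` partition `𝒳`, `g` maps each of them bijectively onto its image, `J x` is
a Jacobian at `x` of the restriction of `g` to the piece that contains `x`, and the Jacobian
determinant is `μ`-a.s. nonzero. (The values of `g` and `J` outside `𝒳` are irrelevant.) -/
structure IsPiecewiseBijective {N : ℕ} {ι : Type*} (μ : Measure (RSpace N)) (𝒳 : Set (RSpace N))
    (piece : ι → Set (RSpace N)) (g : RSpace N → RSpace N)
    (J : RSpace N → RSpace N →L[ℝ] RSpace N) : Prop where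
  measurableSet_piece : ∀ i, MeasurableSet (piece i)
  disjoint : Pairwise fun i j => Disjoint (piece i) (piece j)
  iUnion_eq : ⋃ i, piece i = 𝒳
  injOn : ∀ i, Set.InjOn g (piece i)
  hasFDerivWithinAt : ∀ i, ∀ x ∈ piece i, HasFDerivWithinAt g (J x) (piece i) x
  det_ne_zero : ∀ᵐ x ∂μ, (J x).det ≠ 0

/-! Given `Y = y`, the variable `X` lives on the fibre of `g` over `y` in `𝒳`, which is countable
because each piece contributes at most one point. Hence `H(X|Y) = E[-log p(X|Y)]`, with `p(x|y)` the
conditional mass of the point `x` (`condEntropy_eq_lintegral`). The change of variables formula on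
each piece gives, almost surely, `f_X(X) = |det J(X)| · f_Y(g(X)) · p(X|g(X))`
(`IsPiecewiseBijective.ae_rnDeriv_eq`). Taking logarithms expresses the nonnegative `-log p` as a
sum of three terms; integrating them in the extended sense (`coe_lintegral_eq_extIntegral_add`)
gives the formula.

For the limit, `I(X̂ₙ;X) - I(X̂ₙ;Y) = H(X̂ₙ|Y)` once `H(X̂ₙ)` is finite
(`mutualInfo_sub_mutualInfo`). The dyadic cells shrink to points, so monotone convergence
(`tendsto_lintegral_quantize`) leads to `E[-log p(X|Y)]` again. -/

/-! ### Mutual information between a discrete quantization and another variable. -/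

section MutualInformation

variable {Ω α β γ : Type*} [MeasurableSpace Ω] [MeasurableSpace α] [MeasurableSpace β]
  [MeasurableSpace γ]

/-- A measure carried by a countable set gives a.e. positive mass to the singletons. -/
lemma ae_measure_singleton_ne_zero {μ : Measure α} {S : Set α} (hS : S.Countable)
    (h : ∀ᵐ x ∂μ, x ∈ S) : ∀ᵐ x ∂μ, μ {x} ≠ 0 := by
  have h0 : μ (⋃ x ∈ {x ∈ S | μ {x} = 0}, {x}) = 0 :=
    (measure_biUnion_null_iff (hS.mono (Set.sep_subset _ _))).2 fun x hx => hx.2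
  rw [Set.biUnion_of_singleton] at h0
  filter_upwards [h, measure_eq_zero_iff_ae_notMem.1 h0] with x hx hx'
  exact fun h => hx' ⟨hx, h⟩

lemma ae_measure_fiber_ne_zero [MeasurableSingletonClass γ] (μ : Measure α) {q : α → γ}
    (hq : Measurable q) (hc : (Set.range q).Countable) :
    ∀ᵐ x ∂μ, μ (q ⁻¹' {q x}) ≠ 0 := by
  have h : ∀ᵐ u ∂(μ.map q), u ∈ Set.range q :=
    (ae_map_iff hq.aemeasurable hc.measurableSet).2 (ae_of_all _ fun x => ⟨x, rfl⟩)
  filter_upwards [ae_of_ae_map hq.aemeasurable (ae_measure_singleton_ne_zero hc h)] with x hx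
  rwa [Measure.map_apply hq (measurableSet_singleton _)] at hx

lemma measurable_kernel_fiber [MeasurableEq γ] (κ : Kernel β α) [IsSFiniteKernel κ] {q : α → γ}
    (hq : Measurable q) : Measurable fun p : γ × β => κ p.2 (q ⁻¹' {p.1}) := by
  have ht : MeasurableSet {p : (γ × β) × α | q p.2 = p.1.1} :=
    measurableSet_eq_fun (hq.comp measurable_snd) (measurable_fst.comp measurable_fst)
  exact Kernel.measurable_kernel_prodMk_left (κ := Kernel.prodMkLeft γ κ) ht

variable [StandardBorelSpace α] [Nonempty α] {P : Measure Ω} [IsProbabilityMeasure P]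
  {X : Ω → α} {V : Ω → β} {q : α → γ}

lemma ae_condDistrib_of_ae {p : β × α → Prop} (hX : Measurable X) (hV : Measurable V)
    (hp : MeasurableSet {x | p x}) (h : ∀ᵐ ω ∂P, p (V ω, X ω)) :
    ∀ᵐ v ∂(P.map V), ∀ᵐ x ∂(condDistrib X V P v), p (v, x) := by
  rw [← Measure.ae_compProd_iff hp, compProd_map_condDistrib hX.aemeasurable,
    ae_map_iff (hV.prodMk hX).aemeasurable hp]
  exact h

lemma ae_of_ae_condDistrib {p : β × α → Prop} (hX : Measurable X) (hV : Measurable V)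
    (hp : MeasurableSet {x | p x})
    (h : ∀ᵐ v ∂(P.map V), ∀ᵐ x ∂(condDistrib X V P v), p (v, x)) :
    ∀ᵐ ω ∂P, p (V ω, X ω) := by
  rwa [← Measure.ae_compProd_iff hp, compProd_map_condDistrib hX.aemeasurable,
    ae_map_iff (hV.prodMk hX).aemeasurable hp] at h

lemma ae_condDistrib_fiber_ne_zero [MeasurableEq γ] [MeasurableSingletonClass γ]
    (hX : Measurable X) (hV : Measurable V) (hq : Measurable q) (hc : (Set.range q).Countable) :
    ∀ᵐ ω ∂P, condDistrib X V P (V ω) (q ⁻¹' {q (X ω)}) ≠ 0 := by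
  have hm : Measurable fun p : β × α => condDistrib X V P p.1 (q ⁻¹' {q p.2}) :=
    (measurable_kernel_fiber (condDistrib X V P) hq).comp
      ((hq.comp measurable_snd).prodMk measurable_fst)
  exact ae_of_ae_condDistrib (p := fun p => condDistrib X V P p.1 (q ⁻¹' {q p.2}) ≠ 0) hX hV
    (hm (measurableSet_singleton 0).compl)
    (ae_of_all _ fun v => ae_measure_fiber_ne_zero _ hq hc)

/-- The joint distribution of a discrete quantization of `X` and of `V` has the density
`P(q(X) = u | V = v) / P(q(X) = u)` with respect to the product of the marginals. -/
lemma map_quantization_prodMk_eq_withDensity [MeasurableEq γ] [MeasurableSingletonClass γ]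
    (hX : Measurable X) (hV : Measurable V) (hq : Measurable q) (hc : (Set.range q).Countable) :
    P.map (fun ω => (q (X ω), V ω)) =
      ((P.map fun ω => q (X ω)).prod (P.map V)).withDensity fun p =>
        condDistrib X V P p.2 (q ⁻¹' {p.1}) / (P.map fun ω => q (X ω)) {p.1} := by
  have hU : Measurable fun ω => q (X ω) := hq.comp hX
  set PU := P.map fun ω => q (X ω) with hPU
  have hPUp : IsProbabilityMeasure PU := Measure.isProbabilityMeasure_map hU.aemeasurable
  have hPVp : IsProbabilityMeasure (P.map V) := Measure.isProbabilityMeasure_map hV.aemeasurable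
  have hrange : ∀ᵐ u ∂PU, u ∈ Set.range q :=
    (ae_map_iff hU.aemeasurable hc.measurableSet).2 (ae_of_all _ fun x => ⟨X x, rfl⟩)
  have hmeas := measurable_kernel_fiber (condDistrib X V P) hq
  have hPUm : Measurable fun u => PU {u} := by
    have := measurable_kernel_fiber (Kernel.const Unit PU) (measurable_id (α := γ))
    exact this.comp (measurable_id.prodMk (measurable_const (a := ())))
  have hprob : IsProbabilityMeasure (P.map fun ω => (q (X ω), V ω)) :=
    Measure.isProbabilityMeasure_map (hU.prodMk hV).aemeasurable
  refine Measure.ext_prod fun {A B} hA hB => ?_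
  have hinner : ∀ u, ∫⁻ v in B, condDistrib X V P v (q ⁻¹' {u}) ∂(P.map V) =
      (P.restrict (V ⁻¹' B)) ((fun ω => q (X ω)) ⁻¹' {u}) := fun u => by
    have hs := hq (measurableSet_singleton u)
    rw [← Measure.compProd_apply_prod hB hs, compProd_map_condDistrib hX.aemeasurable,
      Measure.map_apply (hV.prodMk hX) (hB.prod hs),
      Measure.restrict_apply (hU (measurableSet_singleton u)), Set.inter_comm]
    rfl
  -- `γ` itself may be uncountable; on the range of `q` the outer integral becomes a sum over atoms.
  have hAr : PU.restrict A = PU.restrict (A ∩ Set.range q) := by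
    refine Measure.restrict_congr_set ?_
    filter_upwards [hrange] with u hu
    exact propext ⟨fun h => ⟨h, hu⟩, fun h => h.1⟩
  have hcA : (A ∩ Set.range q).Countable := hc.mono Set.inter_subset_right
  have hdens : Measurable fun p : γ × β => condDistrib X V P p.2 (q ⁻¹' {p.1}) / PU {p.1} :=
    hmeas.div (hPUm.comp measurable_fst)
  rw [withDensity_apply _ (hA.prod hB), ← Measure.prod_restrict,
    lintegral_prod _ hdens.aemeasurable, hAr,
    lintegral_countable _ hcA]
  have hterm : ∀ u : ↥(A ∩ Set.range q),
      (∫⁻ v, condDistrib X V P v (q ⁻¹' {u.1}) / PU {u.1} ∂(P.map V).restrict B) * PU {u.1} =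
        (P.restrict (V ⁻¹' B)) ((fun ω => q (X ω)) ⁻¹' {u.1}) := fun u => by
    simp_rw [div_eq_mul_inv]
    rw [lintegral_mul_const _ (Kernel.measurable_coe _ (hq (measurableSet_singleton _))), hinner,
      ← div_eq_mul_inv]
    -- An atom of mass zero is harmless: the right-hand side is then the mass of a subset of a null
    -- event.
    refine ENNReal.div_mul_cancel' (fun h => ?_) (fun h => (measure_ne_top _ _ h).elim)
    rw [hPU, Measure.map_apply hU (measurableSet_singleton _)] at h
    exact Measure.absolutelyContinuous_of_le Measure.restrict_le_self h
  rw [tsum_congr hterm, tsum_measure_preimage_singleton hcA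
    fun u _ => hU (measurableSet_singleton u), Measure.map_apply (hU.prodMk hV) (hA.prod hB),
    Measure.restrict_apply (hU hcA.measurableSet)]
  congr 1
  ext ω
  simp

lemma measurable_ofReal_neg_llr {δ : Type*} [MeasurableSpace δ] (ρ π : Measure δ) :
    Measurable fun x => ENNReal.ofReal (-llr ρ π x) :=
  (measurable_llr ρ π).neg.ennreal_ofReal

/-- With `t` the density, `-t log t ≤ 1 - t ≤ 1`, and `π` has mass one. The negative part of the
log-likelihood ratio is therefore always integrable, which lets finiteness pass from `H(q(X))` to
`H(q(X)|V)`. -/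
lemma lintegral_ofReal_neg_llr_le {δ : Type*} [MeasurableSpace δ] {ρ π : Measure δ}
    [IsProbabilityMeasure ρ] [IsProbabilityMeasure π] (h : ρ ≪ π) :
    ∫⁻ x, ENNReal.ofReal (-llr ρ π x) ∂ρ ≤ 1 := by
  rw [← lintegral_rnDeriv_mul h (measurable_ofReal_neg_llr ρ π).aemeasurable]
  calc ∫⁻ x, ρ.rnDeriv π x * ENNReal.ofReal (-llr ρ π x) ∂π ≤ ∫⁻ _, 1 ∂π := by
        refine lintegral_mono_ae ?_
        filter_upwards [ρ.rnDeriv_ne_top π] with x hx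
        rw [← ENNReal.ofReal_toReal hx, ← ENNReal.ofReal_mul ENNReal.toReal_nonneg, llr]
        refine ENNReal.ofReal_le_one.2 ?_
        set t := (ρ.rnDeriv π x).toReal
        have ht : 0 ≤ t := ENNReal.toReal_nonneg
        rcases ht.eq_or_lt with h0 | h0
        · simp [← h0]
        · have h1 := Real.log_le_sub_one_of_pos (inv_pos.2 h0)
          rw [Real.log_inv] at h1
          have h2 := mul_le_mul_of_nonneg_left h1 ht
          rw [mul_sub, mul_inv_cancel₀ h0.ne'] at h2
          linarith
    _ = 1 := by simp

lemma quantization_absolutelyContinuous_prod [MeasurableEq γ] [MeasurableSingletonClass γ]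
    (hX : Measurable X) (hV : Measurable V) (hq : Measurable q) (hc : (Set.range q).Countable) :
    P.map (fun ω => (q (X ω), V ω)) ≪ (P.map fun ω => q (X ω)).prod (P.map V) := by
  rw [map_quantization_prodMk_eq_withDensity hX hV hq hc]
  exact withDensity_absolutelyContinuous _ _

lemma llr_quantization_ae_eq [MeasurableEq γ] [MeasurableSingletonClass γ]
    (hX : Measurable X) (hV : Measurable V) (hq : Measurable q) (hc : (Set.range q).Countable) :
    ∀ᵐ ω ∂P, llr (P.map fun ω => (q (X ω), V ω)) ((P.map fun ω => q (X ω)).prod (P.map V))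
        (q (X ω), V ω) =
      Real.log (condDistrib X V P (V ω) (q ⁻¹' {q (X ω)})).toReal -
        Real.log (P.map X (q ⁻¹' {q (X ω)})).toReal := by
  have hU : Measurable fun ω => q (X ω) := hq.comp hX
  have hPUm : Measurable fun u => (P.map fun ω => q (X ω)) {u} := by
    have := measurable_kernel_fiber (Kernel.const Unit (P.map fun ω => q (X ω)))
      (measurable_id (α := γ))
    exact this.comp (measurable_id.prodMk (measurable_const (a := ())))
  have h1 := (quantization_absolutelyContinuous_prod hX hV hq hc).ae_le
    (Measure.rnDeriv_withDensity ((P.map fun ω => q (X ω)).prod (P.map V))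
      ((measurable_kernel_fiber (condDistrib X V P) hq).div (hPUm.comp measurable_fst)))
  have h1' : ∀ᵐ p ∂(P.map fun ω => (q (X ω), V ω)), (P.map fun ω => (q (X ω), V ω)).rnDeriv
      ((P.map fun ω => q (X ω)).prod (P.map V)) p =
      condDistrib X V P p.2 (q ⁻¹' {p.1}) / (P.map fun ω => q (X ω)) {p.1} := by
    have e := map_quantization_prodMk_eq_withDensity (P := P) hX hV hq hc
    filter_upwards [h1] with p hp
    rw [e]
    exact hp
  filter_upwards [ae_of_ae_map (hU.prodMk hV).aemeasurable h1',
    ae_condDistrib_fiber_ne_zero (P := P) hX hV hq hc,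
    ae_of_ae_map hX.aemeasurable (ae_measure_fiber_ne_zero (P.map X) hq hc)] with ω hω h2 h3
  have e : (P.map fun ω => q (X ω)) {q (X ω)} = P.map X (q ⁻¹' {q (X ω)}) := by
    rw [Measure.map_apply hU (measurableSet_singleton _),
      Measure.map_apply hX (hq (measurableSet_singleton _))]
    rfl
  have : IsProbabilityMeasure (P.map X) := Measure.isProbabilityMeasure_map hX.aemeasurable
  rw [llr, hω, e, ENNReal.toReal_div, Real.log_div]
  · exact ENNReal.toReal_ne_zero.2 ⟨h2, measure_ne_top _ _⟩
  · exact ENNReal.toReal_ne_zero.2 ⟨h3, measure_ne_top _ _⟩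

lemma measurable_condDistrib_fiber [MeasurableEq γ] (hX : Measurable X) (hV : Measurable V)
    (hq : Measurable q) :
    Measurable fun ω => condDistrib X V P (V ω) (q ⁻¹' {q (X ω)}) :=
  (measurable_kernel_fiber (condDistrib X V P) hq).comp ((hq.comp hX).prodMk hV)

/-- `I(q(X); V) = H(q(X)) - H(q(X) | V)` for a discrete quantization of finite entropy. -/
lemma mutualInfo_quantization [MeasurableEq γ] [MeasurableSingletonClass γ]
    (hX : Measurable X) (hV : Measurable V) (hq : Measurable q) (hc : (Set.range q).Countable)
    (hH : Integrable (fun ω => -Real.log (P.map X (q ⁻¹' {q (X ω)})).toReal) P) :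
    Integrable (fun ω => -Real.log (condDistrib X V P (V ω) (q ⁻¹' {q (X ω)})).toReal) P ∧
      0 ≤ (∫ ω, -Real.log (P.map X (q ⁻¹' {q (X ω)})).toReal ∂P) -
        ∫ ω, -Real.log (condDistrib X V P (V ω) (q ⁻¹' {q (X ω)})).toReal ∂P ∧
      mutualInfo (fun ω => q (X ω)) V P = ENNReal.ofReal
        (((∫ ω, -Real.log (P.map X (q ⁻¹' {q (X ω)})).toReal ∂P) -
        ∫ ω, -Real.log (condDistrib X V P (V ω) (q ⁻¹' {q (X ω)})).toReal ∂P) / Real.log 2) := by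
  have hU : Measurable fun ω => q (X ω) := hq.comp hX
  have hac := quantization_absolutelyContinuous_prod (P := P) hX hV hq hc
  have hllr := llr_quantization_ae_eq (P := P) hX hV hq hc
  set ρ := P.map fun ω => (q (X ω), V ω) with hρ
  set π := (P.map fun ω => q (X ω)).prod (P.map V) with hπ
  have : IsProbabilityMeasure ρ := Measure.isProbabilityMeasure_map (hU.prodMk hV).aemeasurable
  have : IsProbabilityMeasure (P.map V) := Measure.isProbabilityMeasure_map hV.aemeasurable
  have : IsProbabilityMeasure (P.map fun ω => q (X ω)) :=
    Measure.isProbabilityMeasure_map hU.aemeasurable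
  have hL : Measurable fun ω => llr ρ π (q (X ω), V ω) :=
    (measurable_llr ρ π).comp (hU.prodMk hV)
  have hneg : ∫⁻ ω, ENNReal.ofReal (-llr ρ π (q (X ω), V ω)) ∂P ≤ 1 := by
    have h := lintegral_ofReal_neg_llr_le hac
    rw [hρ, lintegral_map (measurable_ofReal_neg_llr _ _)
      (hU.prodMk hV)] at h
    exact h
  have hnegint : Integrable (fun ω => max (-llr ρ π (q (X ω), V ω)) 0) P := by
    refine ⟨(hL.neg.max measurable_const).aestronglyMeasurable, ?_⟩
    have hnn : 0 ≤ᵐ[P] fun ω => max (-llr ρ π (q (X ω), V ω)) 0 :=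
      ae_of_all _ fun ω => le_max_right _ _
    rw [hasFiniteIntegral_iff_ofReal hnn]
    refine lt_of_le_of_lt (lintegral_mono fun ω => ?_) (hneg.trans_lt ENNReal.one_lt_top)
    simp [ENNReal.ofReal_max]
  have hC0 : ∀ ω, 0 ≤ -Real.log (condDistrib X V P (V ω) (q ⁻¹' {q (X ω)})).toReal := fun ω =>
    neg_nonneg.2 (Real.log_nonpos ENNReal.toReal_nonneg
      (ENNReal.toReal_le_of_le_ofReal zero_le_one (by simpa using prob_le_one)))
  have hC : Integrable
      (fun ω => -Real.log (condDistrib X V P (V ω) (q ⁻¹' {q (X ω)})).toReal) P := by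
    -- `-log P(q(X)|V) = -log P(q(X)) - llr`, and `-llr` is at most its positive part.
    refine (hH.add hnegint).mono' ?_ ?_
    · exact (measurable_condDistrib_fiber hX hV
        hq).ennreal_toReal.log.neg.aestronglyMeasurable
    · filter_upwards [hllr] with ω hω
      rw [Real.norm_of_nonneg (hC0 ω)]
      have := le_max_left (-llr ρ π (q (X ω), V ω)) 0
      simp only [Pi.add_apply]
      linarith
  have hLint : Integrable (fun ω => llr ρ π (q (X ω), V ω)) P := by
    refine (hH.sub hC).congr ?_
    filter_upwards [hllr] with ω hω
    simp only [Pi.sub_apply, hω]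
    ring
  have hLρ : Integrable (llr ρ π) ρ := by
    rw [hρ, integrable_map_measure (measurable_llr _ _).aestronglyMeasurable
      (hU.prodMk hV).aemeasurable]
    exact hLint
  have hint : ∫ p, llr ρ π p ∂ρ = (∫ ω, -Real.log (P.map X (q ⁻¹' {q (X ω)})).toReal ∂P) -
        ∫ ω, -Real.log (condDistrib X V P (V ω) (q ⁻¹' {q (X ω)})).toReal ∂P := by
    rw [hρ, integral_map (hU.prodMk hV).aemeasurable (measurable_llr _ _).aestronglyMeasurable,
      ← integral_sub hH hC]
    refine integral_congr_ae ?_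
    filter_upwards [hllr] with ω hω
    rw [← hρ, hω]
    ring
  refine ⟨hC, ?_, ?_⟩
  -- The difference of entropies is a divergence between two probability measures, hence
  -- nonnegative.
  · rw [← hint, ← InformationTheory.toReal_klDiv_of_measure_eq hac (by simp)]
    exact ENNReal.toReal_nonneg
  · rw [mutualInfo, InformationTheory.klDiv_of_ac_of_integrable hac hLρ, hint,
      ENNReal.ofReal_div_of_pos (Real.log_pos one_lt_two)]
    simp

lemma condDistrib_self_fiber [MeasurableSingletonClass γ]
    (hX : Measurable X) (hq : Measurable q) :
    ∀ᵐ ω ∂P, condDistrib X X P (X ω) (q ⁻¹' {q (X ω)}) = 1 := by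
  filter_upwards [ae_of_ae_map hX.aemeasurable (condDistrib_self (μ := P) X)] with ω hω
  rw [hω, Kernel.id_apply, Measure.dirac_apply' _ (hq (measurableSet_singleton _))]
  simp

/-- `H(q(X))` is finite if `I(q(X); X)` is. -/
lemma integrable_log_of_mutualInfo_ne_top [MeasurableEq γ] [MeasurableSingletonClass γ]
    (hX : Measurable X) (hq : Measurable q) (hc : (Set.range q).Countable)
    (h : mutualInfo (fun ω => q (X ω)) X P ≠ ⊤) :
    Integrable (fun ω => -Real.log (P.map X (q ⁻¹' {q (X ω)})).toReal) P := by
  have hU : Measurable fun ω => q (X ω) := hq.comp hX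
  have hkl : InformationTheory.klDiv (P.map fun ω => (q (X ω), X ω))
      ((P.map fun ω => q (X ω)).prod (P.map X)) ≠ ⊤ := fun hk => by
    rw [mutualInfo, hk, ENNReal.top_div_of_ne_top ENNReal.ofReal_ne_top] at h
    exact h rfl
  have hL := (InformationTheory.klDiv_ne_top_iff.1 hkl).2
  rw [integrable_map_measure (measurable_llr _ _).aestronglyMeasurable
    (hU.prodMk hX).aemeasurable] at hL
  -- Given `X` itself, the cell of `X` has conditional mass one, so only `-log P(q(X))` is left of
  -- the log-likelihood ratio.
  refine hL.congr ?_
  filter_upwards [llr_quantization_ae_eq (P := P) hX hX hq hc,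
    condDistrib_self_fiber (P := P) hX hq] with ω h1 h2
  simp [h1, h2]

end MutualInformation

/-! ### Entropy of discrete distributions. -/

section Entropy

variable {Ω α β : Type*} [MeasurableSpace Ω] [MeasurableSpace α] [MeasurableSpace β]

/-- A cell containing `x` is at least as heavy as `{x}`, so coarsening can only lower `-log`;
positivity of the atom keeps the default value `Real.logb 2 0 = 0` away. -/
lemma entropy_le_lintegral [MeasurableSingletonClass α] (μ : Measure α) [IsProbabilityMeasure μ]
    (h0 : ∀ᵐ x ∂μ, μ {x} ≠ 0) :
    entropy μ ≤ ∫⁻ x, ENNReal.ofReal (-Real.logb 2 (μ {x}).toReal) ∂μ := by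
  refine iSup_le fun k => iSup_le fun q => iSup_le fun hq => ?_
  have hm : ∀ j, MeasurableSet (q ⁻¹' {j}) := fun j => hq (measurableSet_singleton j)
  calc ∑ j : Fin k, ENNReal.ofReal (-(μ.real (q ⁻¹' {j}) * Real.logb 2 (μ.real (q ⁻¹' {j}))))
      ≤ ∑ j : Fin k, ∫⁻ x in q ⁻¹' {j}, ENNReal.ofReal (-Real.logb 2 (μ {x}).toReal) ∂μ := by
        refine Finset.sum_le_sum fun j _ => ?_
        rw [← mul_neg, ENNReal.ofReal_mul measureReal_nonneg, ofReal_measureReal, mul_comm,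
          ← setLIntegral_const]
        refine setLIntegral_mono_ae' (hm j) ?_
        filter_upwards [h0] with x hx hxj
        refine ENNReal.ofReal_le_ofReal (neg_le_neg ?_)
        have hpos : 0 < (μ {x}).toReal := ENNReal.toReal_pos hx (measure_ne_top _ _)
        refine Real.logb_le_logb_of_le one_lt_two hpos ?_
        exact measureReal_mono (Set.singleton_subset_iff.2 hxj)
    _ = ∫⁻ x, ENNReal.ofReal (-Real.logb 2 (μ {x}).toReal) ∂μ := by
        have hd : Set.PairwiseDisjoint (↑(Finset.univ : Finset (Fin k))) fun j => q ⁻¹' {j} :=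
          fun i _ j _ hij => Disjoint.preimage q (Set.disjoint_singleton.2 hij)
        rw [← lintegral_biUnion_finset hd fun j _ => hm j]
        have : (⋃ j ∈ (Finset.univ : Finset (Fin k)), q ⁻¹' {j}) = Set.univ := by
          ext x; simp
        rw [this, Measure.restrict_univ]

/-- The witnessing quantization isolates each point of `F` and sends all other points to one extra
value, whose nonnegative contribution is dropped. -/
lemma sum_le_entropy [MeasurableSingletonClass α] (μ : Measure α) (F : Finset α) :
    ∑ x ∈ F, ENNReal.ofReal (-(μ.real {x} * Real.logb 2 (μ.real {x}))) ≤ entropy μ := by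
  classical
  let q : α → Fin (F.card + 1) := fun x =>
    if h : x ∈ F then (F.equivFin ⟨x, h⟩).castSucc else Fin.last _
  have hpre : ∀ i : Fin F.card, q ⁻¹' {i.castSucc} = {(F.equivFin.symm i : α)} := fun i => by
    ext x
    simp only [Set.mem_preimage, Set.mem_singleton_iff, q]
    split_ifs with h
    · rw [Fin.castSucc_inj, ← Equiv.eq_symm_apply, Subtype.ext_iff]
    · refine iff_of_false (Fin.castSucc_ne_last i).symm fun hx => h ?_
      rw [hx]
      exact (F.equivFin.symm i).2
  have hlast : q ⁻¹' {Fin.last _} = (F : Set α)ᶜ := by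
    ext x
    simp only [Set.mem_preimage, Set.mem_singleton_iff, q, Set.mem_compl_iff, Finset.mem_coe]
    split_ifs with h
    · exact iff_of_false (Fin.castSucc_ne_last _) (not_not.2 h)
    · exact iff_of_true rfl h
  have hq : Measurable q := measurable_to_countable' fun j => by
    refine Fin.lastCases ?_ (fun i => ?_) j
    · rw [hlast]; exact F.measurableSet.compl
    · rw [hpre]; exact measurableSet_singleton _
  refine le_trans ?_ (le_iSup_of_le (F.card + 1) (le_iSup_of_le q (le_iSup_of_le hq le_rfl)))
  rw [Fin.sum_univ_castSucc]
  refine le_add_right (le_of_eq ?_)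
  rw [← Finset.sum_coe_sort, ← Equiv.sum_comp F.equivFin.symm]
  simp_rw [hpre]

/-- The entropy of a distribution carried by a countable set. -/
lemma entropy_eq_lintegral [MeasurableSingletonClass α] (μ : Measure α) [IsProbabilityMeasure μ]
    {S : Set α} (hS : S.Countable) (h : ∀ᵐ x ∂μ, x ∈ S) :
    entropy μ = ∫⁻ x, ENNReal.ofReal (-Real.logb 2 (μ {x}).toReal) ∂μ := by
  refine le_antisymm (entropy_le_lintegral μ (ae_measure_singleton_ne_zero hS h)) ?_
  have e : ∫⁻ x, ENNReal.ofReal (-Real.logb 2 (μ {x}).toReal) ∂μ =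
      ∫⁻ x in S, ENNReal.ofReal (-Real.logb 2 (μ {x}).toReal) ∂μ := by
    rw [Measure.restrict_eq_self_of_ae_mem h]
  rw [e, lintegral_countable _ hS, ENNReal.tsum_eq_iSup_sum]
  refine iSup_le fun F => ?_
  refine le_trans (le_of_eq ?_) (sum_le_entropy μ (F.map (Function.Embedding.subtype _)))
  rw [Finset.sum_map]
  refine Finset.sum_congr rfl fun x _ => ?_
  simp only [Function.Embedding.subtype_apply]
  rw [← mul_neg, ENNReal.ofReal_mul measureReal_nonneg, ofReal_measureReal, mul_comm]
  rfl

lemma measurable_condDistrib_singleton [StandardBorelSpace α] [Nonempty α] [MeasurableEq α]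
    {P : Measure Ω} [IsFiniteMeasure P] (X : Ω → α) (Y : Ω → β) :
    Measurable fun p : β × α => condDistrib X Y P p.1 {p.2} :=
  (measurable_kernel_fiber (condDistrib X Y P) measurable_id).comp
    (measurable_snd.prodMk measurable_fst)

/-- `H(X | Y) = E[-log P(X | Y)]` if the conditional distributions are discrete. -/
lemma condEntropy_eq_lintegral [StandardBorelSpace α] [Nonempty α] [MeasurableEq α]
    [MeasurableSingletonClass α] {P : Measure Ω}
    [IsProbabilityMeasure P] {X : Ω → α} {Y : Ω → β} (hX : Measurable X) (hY : Measurable Y)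
    (h : ∀ᵐ y ∂(P.map Y), ∃ S : Set α, S.Countable ∧ ∀ᵐ x ∂(condDistrib X Y P y), x ∈ S) :
    condEntropy X Y P =
      ∫⁻ ω, ENNReal.ofReal (-Real.logb 2 (condDistrib X Y P (Y ω) {X ω}).toReal) ∂P := by
  have hm : Measurable fun p : β × α =>
      ENNReal.ofReal (-Real.logb 2 (condDistrib X Y P p.1 {p.2}).toReal) :=
    ((Real.measurable_log.comp
      (measurable_condDistrib_singleton X Y).ennreal_toReal).div_const _).neg.ennreal_ofReal
  have e : ∫⁻ ω, ENNReal.ofReal (-Real.logb 2 (condDistrib X Y P (Y ω) {X ω}).toReal) ∂P =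
      ∫⁻ p, ENNReal.ofReal (-Real.logb 2 (condDistrib X Y P p.1 {p.2}).toReal)
        ∂(P.map fun ω => (Y ω, X ω)) := by
    rw [lintegral_map hm (hY.prodMk hX)]
  rw [e, ← compProd_map_condDistrib hX.aemeasurable, Measure.lintegral_compProd hm, condEntropy]
  refine lintegral_congr_ae ?_
  filter_upwards [h] with y ⟨S, hS, hy⟩
  exact entropy_eq_lintegral _ hS hy

end Entropy

/-! ### Dyadic quantization and refinement to points. -/

section Quantize

variable {N : ℕ}

lemma quantize_eq_iff {n : ℕ} {x z : RSpace N} :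
    quantize n z = quantize n x ↔ ∀ j, ⌊(2 : ℝ) ^ n * z j⌋ = ⌊(2 : ℝ) ^ n * x j⌋ := by
  have h2 : ((2 : ℝ) ^ n) ≠ 0 := by positivity
  constructor
  · intro h j
    have := congrArg (fun w : RSpace N => w j) h
    simp only [quantize, div_left_inj' h2] at this
    exact_mod_cast this
  · intro h
    ext j
    simp [quantize, h j]

lemma measurable_quantize (n : ℕ) : Measurable (quantize (N := N) n) := by
  unfold quantize
  refine (WithLp.measurable_toLp 2 _).comp (measurable_pi_lambda _ fun j => ?_)
  refine Measurable.div_const ?_ _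
  have hj : Measurable fun x : RSpace N => (2 : ℝ) ^ n * x j := by fun_prop
  exact (measurable_from_top (f := fun k : ℤ => (k : ℝ))).comp (Int.measurable_floor.comp hj)

lemma countable_range_quantize (n : ℕ) : (Set.range (quantize (N := N) n)).Countable := by
  refine (Set.countable_range fun k : Fin N → ℤ =>
    (WithLp.toLp 2 fun j => (k j : ℝ) / (2 : ℝ) ^ n : RSpace N)).mono ?_
  rintro _ ⟨x, rfl⟩
  exact ⟨fun j => ⌊(2 : ℝ) ^ n * x j⌋, rfl⟩

lemma antitone_quantize_fiber (x : RSpace N) :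
    Antitone fun n => quantize n ⁻¹' {quantize n x} := by
  refine antitone_nat_of_succ_le fun n z hz => ?_
  simp only [Set.mem_preimage, Set.mem_singleton_iff, quantize_eq_iff] at hz ⊢
  intro j
  -- Integer division of the finer index by two gives the coarser one, so dyadic cells are nested.
  have key : ∀ t : ℝ, ⌊(2 : ℝ) ^ n * t⌋ = ⌊(2 : ℝ) ^ (n + 1) * t⌋ / 2 := fun t => by
    have := Int.floor_div_natCast ((2 : ℝ) ^ (n + 1) * t) 2
    rw [show (2 : ℝ) ^ n * t = (2 : ℝ) ^ (n + 1) * t / (2 : ℕ) by push_cast; ring, this]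
    rfl
  rw [key, key, hz j]

lemma iInter_quantize_fiber (x : RSpace N) :
    ⋂ n, quantize n ⁻¹' {quantize n x} = {x} := by
  ext z
  simp only [Set.mem_iInter, Set.mem_preimage, Set.mem_singleton_iff]
  refine ⟨fun h => ?_, fun h n => by rw [h]⟩
  ext j
  by_contra hne
  have hpos : 0 < |z j - x j| := abs_pos.2 (sub_ne_zero.2 hne)
  obtain ⟨n, hn⟩ := pow_unbounded_of_one_lt (|z j - x j|)⁻¹ (one_lt_two (α := ℝ))
  have h1 := Int.abs_sub_lt_one_of_floor_eq_floor (quantize_eq_iff.1 (h n) j)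
  rw [← mul_sub, abs_mul, abs_of_pos (by positivity)] at h1
  have h2 := mul_lt_mul_of_pos_right hn hpos
  rw [inv_mul_cancel₀ hpos.ne'] at h2
  linarith

lemma tendsto_measure_quantize_fiber (μ : Measure (RSpace N)) [IsFiniteMeasure μ] (x : RSpace N) :
    Tendsto (fun n => μ (quantize n ⁻¹' {quantize n x})) atTop (𝓝 (μ {x})) := by
  rw [← iInter_quantize_fiber x]
  exact tendsto_measure_iInter_atTop
    (fun n => (measurable_quantize n (measurableSet_singleton _)).nullMeasurableSet)
    (antitone_quantize_fiber x) ⟨0, measure_ne_top _ _⟩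

variable {Ω β : Type*} [MeasurableSpace Ω] [MeasurableSpace β] {P : Measure Ω}
  [IsProbabilityMeasure P] {X : Ω → RSpace N} {Y : Ω → β}

/-- Monotone convergence: the conditional masses of the nested cells decrease to the atom at `X ω`.
Almost sure positivity of that atom is what makes the logarithms monotone and convergent. -/
lemma tendsto_lintegral_quantize (hX : Measurable X) (hY : Measurable Y)
    (h0 : ∀ᵐ ω ∂P, condDistrib X Y P (Y ω) {X ω} ≠ 0) :
    Tendsto (fun n => ∫⁻ ω, ENNReal.ofReal (-Real.logb 2
        (condDistrib X Y P (Y ω) (quantize n ⁻¹' {quantize n (X ω)})).toReal) ∂P) atTop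
      (𝓝 (∫⁻ ω, ENNReal.ofReal (-Real.logb 2 (condDistrib X Y P (Y ω) {X ω}).toReal) ∂P)) := by
  refine lintegral_tendsto_of_tendsto_of_monotone (fun n => ?_) ?_ ?_
  · exact ((Real.measurable_log.comp (measurable_condDistrib_fiber hX hY
      (measurable_quantize n)).ennreal_toReal).div_const _).neg.ennreal_ofReal.aemeasurable
  · filter_upwards [h0] with ω hω n m hnm
    refine ENNReal.ofReal_le_ofReal (neg_le_neg ?_)
    refine Real.logb_le_logb_of_le one_lt_two (ENNReal.toReal_pos (fun h => hω ?_)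
      (measure_ne_top _ _)) (measureReal_mono (antitone_quantize_fiber (X ω) hnm))
    have hmem : X ω ∈ quantize m ⁻¹' {quantize m (X ω)} := rfl
    exact measure_mono_null (Set.singleton_subset_iff.2 hmem) h
  · filter_upwards [h0] with ω hω
    have h1 := (ENNReal.tendsto_toReal (measure_ne_top _ _)).comp
      (tendsto_measure_quantize_fiber (condDistrib X Y P (Y ω)) (X ω))
    have h2 : (condDistrib X Y P (Y ω) {X ω}).toReal ≠ 0 :=
      ENNReal.toReal_ne_zero.2 ⟨hω, measure_ne_top _ _⟩
    exact ENNReal.tendsto_ofReal ((h1.log h2).div_const _).neg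

/-- The loss of information about the quantization of `X` is its conditional entropy. -/
lemma mutualInfo_sub_mutualInfo (hX : Measurable X) (hY : Measurable Y) (n : ℕ)
    (h : mutualInfo (fun ω => quantize n (X ω)) X P ≠ ⊤) :
    (mutualInfo (fun ω => quantize n (X ω)) X P : EReal) -
        (mutualInfo (fun ω => quantize n (X ω)) Y P : EReal) =
      ((∫⁻ ω, ENNReal.ofReal (-Real.logb 2
        (condDistrib X Y P (Y ω) (quantize n ⁻¹' {quantize n (X ω)})).toReal) ∂P : ℝ≥0∞) :
          EReal) := by
  have hq := measurable_quantize (N := N) n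
  have hc := countable_range_quantize (N := N) n
  have hH := integrable_log_of_mutualInfo_ne_top hX hq hc h
  obtain ⟨-, hX0, hXeq⟩ := mutualInfo_quantization hX hX hq hc hH
  obtain ⟨hC, hY0, hYeq⟩ := mutualInfo_quantization hX hY hq hc hH
  -- Given `X`, its quantization has no entropy left, so `I(q(X);X) = H(q(X))`; this finite term
  -- cancels in the difference.
  have hself : ∫ ω, -Real.log
      (condDistrib X X P (X ω) (quantize n ⁻¹' {quantize n (X ω)})).toReal ∂P = 0 := by
    rw [integral_eq_zero_of_ae]
    filter_upwards [condDistrib_self_fiber (P := P) hX hq] with ω hω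
    simp [hω]
  have hlog := Real.log_pos one_lt_two
  rw [hself] at hXeq hX0
  have hCeq : ∫⁻ ω, ENNReal.ofReal (-Real.logb 2
      (condDistrib X Y P (Y ω) (quantize n ⁻¹' {quantize n (X ω)})).toReal) ∂P =
      ENNReal.ofReal ((∫ ω, -Real.log
        (condDistrib X Y P (Y ω) (quantize n ⁻¹' {quantize n (X ω)})).toReal ∂P) /
          Real.log 2) := by
    rw [← integral_div, ofReal_integral_eq_lintegral_ofReal (hC.div_const _)]
    · simp only [Real.logb, neg_div]
    · refine ae_of_all _ fun ω => div_nonneg (neg_nonneg.2 ?_) hlog.le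
      exact Real.log_nonpos ENNReal.toReal_nonneg
        (ENNReal.toReal_le_of_le_ofReal zero_le_one (by simpa using prob_le_one))
  have hC0 : 0 ≤ ∫ ω, -Real.log
      (condDistrib X Y P (Y ω) (quantize n ⁻¹' {quantize n (X ω)})).toReal ∂P :=
    integral_nonneg fun ω => neg_nonneg.2 (Real.log_nonpos ENNReal.toReal_nonneg
        (ENNReal.toReal_le_of_le_ofReal zero_le_one (by simpa using prob_le_one)))
  rw [hXeq, hYeq, hCeq, EReal.coe_ennreal_ofReal, EReal.coe_ennreal_ofReal,
    EReal.coe_ennreal_ofReal, max_eq_left (div_nonneg hX0 hlog.le),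
    max_eq_left (div_nonneg hY0 hlog.le), max_eq_left (div_nonneg hC0 hlog.le), ← EReal.coe_sub]
  congr 1
  ring

end Quantize

/-! ### Change of variables for piecewise bijective maps. -/

section PiecewiseBijective

variable {N : ℕ} {ι : Type*} {μ : Measure (RSpace N)} {𝒳 : Set (RSpace N)}
  {piece : ι → Set (RSpace N)} {g : RSpace N → RSpace N} {J : RSpace N → RSpace N →L[ℝ] RSpace N}

lemma IsPiecewiseBijective.measurableSet [Countable ι]
    (hg : IsPiecewiseBijective μ 𝒳 piece g J) :
    MeasurableSet 𝒳 := by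
  rw [← hg.iUnion_eq]
  exact MeasurableSet.iUnion hg.measurableSet_piece

lemma IsPiecewiseBijective.exists_mem_piece
    (hg : IsPiecewiseBijective μ 𝒳 piece g J)
    {x : RSpace N} (hx : x ∈ 𝒳) : ∃ i, x ∈ piece i := by
  rw [← hg.iUnion_eq] at hx
  exact Set.mem_iUnion.1 hx

lemma IsPiecewiseBijective.congr
    (hg : IsPiecewiseBijective μ 𝒳 piece g J)
    {g' : RSpace N → RSpace N} (h : Set.EqOn g' g 𝒳) :
    IsPiecewiseBijective μ 𝒳 piece g' J := by
  have hsub : ∀ i, Set.EqOn g' g (piece i) := fun i =>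
    h.mono (hg.iUnion_eq ▸ Set.subset_iUnion piece i)
  exact ⟨hg.measurableSet_piece, hg.disjoint, hg.iUnion_eq, fun i => (hg.injOn i).congr (hsub i).symm,
    fun i x hx => (hg.hasFDerivWithinAt i x hx).congr (hsub i) (hsub i hx), hg.det_ne_zero⟩

/-- Differentiability makes `g` continuous on each Borel piece, and countably many pieces can be
glued measurably. -/
lemma IsPiecewiseBijective.exists_measurable_eqOn [Countable ι]
    (hg : IsPiecewiseBijective μ 𝒳 piece g J) :
    ∃ g' : RSpace N → RSpace N, Measurable g' ∧ Set.EqOn g' g 𝒳 := by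
  classical
  rcases isEmpty_or_nonempty ι with hι | hι
  · refine ⟨0, measurable_const, fun x hx => ?_⟩
    obtain ⟨i, -⟩ := hg.exists_mem_piece hx
    exact hι.elim i
  obtain ⟨g', hg'm, hg'⟩ := exists_measurable_piecewise piece hg.measurableSet_piece
    (fun i => (piece i).piecewise g 0)
    (fun i => ContinuousOn.measurable_piecewise
      (fun x hx => (hg.hasFDerivWithinAt i x hx).continuousWithinAt)
      continuous_zero.continuousOn (hg.measurableSet_piece i))
    (fun i j hij x hx => ((hg.disjoint hij).le_bot hx).elim)
  refine ⟨g', hg'm, fun x hx => ?_⟩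
  obtain ⟨i, hi⟩ := hg.exists_mem_piece hx
  rw [hg' i hi]
  exact Set.piecewise_eq_of_mem _ _ _ hi

/-- On the part of a piece sent into a null set `B`, the integral of `|det J|` is the volume of the
image, which is zero. So `det J` vanishes almost everywhere there, which `X` almost surely avoids.
-/
lemma IsPiecewiseBijective.map_absolutelyContinuous [Countable ι]
    (hg : IsPiecewiseBijective μ 𝒳 piece g J)
    (hgm : Measurable g) (hμ : μ ≪ volume) (hmem : ∀ᵐ x ∂μ, x ∈ 𝒳) : μ.map g ≪ volume := by
  refine Measure.AbsolutelyContinuous.mk fun B hB hB0 => ?_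
  have key : ∀ i, ∀ᵐ x ∂(volume : Measure (RSpace N)), x ∈ piece i ∩ g ⁻¹' B → (J x).det = 0 := by
    intro i
    have hs : MeasurableSet (piece i ∩ g ⁻¹' B) := (hg.measurableSet_piece i).inter (hgm hB)
    have hd : ∀ x ∈ piece i ∩ g ⁻¹' B, HasFDerivWithinAt g (J x) (piece i ∩ g ⁻¹' B) x :=
      fun x hx => (hg.hasFDerivWithinAt i x hx.1).mono Set.inter_subset_left
    have h := lintegral_abs_det_fderiv_eq_addHaar_image volume hs hd
      ((hg.injOn i).mono Set.inter_subset_left)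
    rw [measure_mono_null (Set.image_subset_iff.2 Set.inter_subset_right) hB0,
      lintegral_eq_zero_iff' (aemeasurable_ofReal_abs_det_fderivWithin volume hs hd)] at h
    filter_upwards [(ae_restrict_iff' hs).1 h] with x hx hxm
    simpa using hx hxm
  rw [Measure.map_apply hgm hB, measure_eq_zero_iff_ae_notMem]
  filter_upwards [hmem, hg.det_ne_zero, hμ.ae_le (ae_all_iff.2 key)] with x hx hdet hx' hxB
  obtain ⟨i, hi⟩ := hg.exists_mem_piece hx
  exact hdet (hx' i ⟨hi, hxB⟩)

lemma IsPiecewiseBijective.countable_fiber [Countable ι]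
    (hg : IsPiecewiseBijective μ 𝒳 piece g J)
    (y : RSpace N) : {x | x ∈ 𝒳 ∧ g x = y}.Countable := by
  have : {x | x ∈ 𝒳 ∧ g x = y} ⊆ ⋃ i, {x | x ∈ piece i ∧ g x = y} := fun x hx => by
    obtain ⟨i, hi⟩ := hg.exists_mem_piece hx.1
    exact Set.mem_iUnion.2 ⟨i, hi, hx.2⟩
  refine (Set.countable_iUnion fun i => Set.Subsingleton.countable ?_).mono this
  exact fun x hx z hz => hg.injOn i hx.1 hz.1 (hx.2.trans hz.2.symm)

variable {Ω : Type*} [MeasurableSpace Ω] {P : Measure Ω} [IsProbabilityMeasure P]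
  {X : Ω → RSpace N}

lemma IsPiecewiseBijective.ae_condDistrib_mem_fiber [Countable ι]
    (hg : IsPiecewiseBijective (P.map X) 𝒳 piece g J) (hgm : Measurable g) (hX : Measurable X)
    (hmem : ∀ᵐ ω ∂P, X ω ∈ 𝒳) :
    ∀ᵐ y ∂(P.map fun ω => g (X ω)), ∀ᵐ x ∂(condDistrib X (fun ω => g (X ω)) P y),
      x ∈ {x | x ∈ 𝒳 ∧ g x = y} := by
  refine ae_condDistrib_of_ae (p := fun p => p.2 ∈ 𝒳 ∧ g p.2 = p.1) hX (hgm.comp hX) ?_ ?_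
  · exact (measurable_snd hg.measurableSet).inter
      (measurableSet_eq_fun (hgm.comp measurable_snd) measurable_fst)
  · filter_upwards [hmem] with ω hω using ⟨hω, rfl⟩

/-- The density of `X` on a piece, in terms of the conditional probability of the piece and of the
density of `g(X)`. -/
lemma IsPiecewiseBijective.ae_rnDeriv_eq_on_piece
    (hg : IsPiecewiseBijective (P.map X) 𝒳 piece g J) (hgm : Measurable g) (hX : Measurable X)
    (hμ : P.map X ≪ volume) (hν : (P.map fun ω => g (X ω)) ≪ volume) (i : ι) :
    ∀ᵐ x ∂volume, x ∈ piece i → (P.map X).rnDeriv volume x =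
      ENNReal.ofReal |(J x).det| * ((P.map fun ω => g (X ω)).rnDeriv volume (g x) *
        condDistrib X (fun ω => g (X ω)) P (g x) (piece i)) := by
  have hY : Measurable fun ω => g (X ω) := hgm.comp hX
  have : IsProbabilityMeasure (P.map X) := Measure.isProbabilityMeasure_map hX.aemeasurable
  set ν := P.map fun ω => g (X ω) with hνdef
  have : IsProbabilityMeasure ν := Measure.isProbabilityMeasure_map hY.aemeasurable
  set κ := condDistrib X (fun ω => g (X ω)) P with hκ
  have hpi := hg.measurableSet_piece i
  have hκm : Measurable fun y => κ y (piece i) := Kernel.measurable_coe κ hpi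
  have key : ∀ s, MeasurableSet s → ∫⁻ x in s ∩ piece i,
      ENNReal.ofReal |(J x).det| * (ν.rnDeriv volume (g x) * κ (g x) (piece i)) =
        P.map X (s ∩ piece i) := by
    intro s hs
    have hA : MeasurableSet (s ∩ piece i) := hs.inter hpi
    have hd : ∀ x ∈ s ∩ piece i, HasFDerivWithinAt g (J x) (s ∩ piece i) x :=
      fun x hx => (hg.hasFDerivWithinAt i x hx.2).mono Set.inter_subset_right
    have hinj := (hg.injOn i).mono (Set.inter_subset_right (s := s))
    have hgA : MeasurableSet (g '' (s ∩ piece i)) := measurable_image_of_fderivWithin hA hd hinj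
    -- With `A = s ∩ piece i`, the change of variables yields `∫ κ(y, piece i) dν(y)` over `g(A)`,
    -- i.e. `P(g(X) ∈ g(A), X ∈ piece i)`; injectivity on the piece identifies this event with `X ∈
    -- A`.
    rw [← lintegral_image_eq_lintegral_abs_det_fderiv_mul volume hA hd hinj
      fun y => ν.rnDeriv volume y * κ y (piece i),
      setLIntegral_rnDeriv_mul hν hκm.aemeasurable hgA, ← Measure.compProd_apply_prod hgA hpi,
      compProd_map_condDistrib hX.aemeasurable, Measure.map_apply (hY.prodMk hX) (hgA.prod hpi),
      Measure.map_apply hX hA]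
    congr 1
    ext ω
    simp only [Set.mem_preimage, Set.mem_prod, Set.mem_inter_iff]
    constructor
    · rintro ⟨⟨x, hx, hxe⟩, hω⟩
      rw [← hg.injOn i hx.2 hω hxe]
      exact hx
    · exact fun h => ⟨⟨X ω, h, rfl⟩, h.2⟩
  rw [← ae_restrict_iff' hpi]
  refine AEMeasurable.ae_eq_of_forall_setLIntegral_eq
    (Measure.measurable_rnDeriv _ _).aemeasurable ?_ ?_ ?_ ?_
  · exact (aemeasurable_ofReal_abs_det_fderivWithin volume hpi
      (hg.hasFDerivWithinAt i)).mul ((((Measure.measurable_rnDeriv _ _).mul hκm).comp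
        hgm).aemeasurable)
  · rw [Measure.setLIntegral_rnDeriv hμ]
    exact measure_ne_top _ _
  · have := key Set.univ MeasurableSet.univ
    rw [Set.univ_inter] at this
    rw [this]
    exact measure_ne_top _ _
  · intro s hs _
    rw [Measure.restrict_restrict hs, key s hs, Measure.setLIntegral_rnDeriv hμ]

/-- The conditional probability of `X` given `g(X)` in terms of the densities. -/
lemma IsPiecewiseBijective.ae_rnDeriv_eq [Countable ι]
    (hg : IsPiecewiseBijective (P.map X) 𝒳 piece g J) (hgm : Measurable g) (hX : Measurable X)
    (hmem : ∀ᵐ ω ∂P, X ω ∈ 𝒳)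
    (hμ : P.map X ≪ volume) (hν : (P.map fun ω => g (X ω)) ≪ volume) :
    ∀ᵐ ω ∂P, (P.map X).rnDeriv volume (X ω) =
      ENNReal.ofReal |(J (X ω)).det| * ((P.map fun ω => g (X ω)).rnDeriv volume (g (X ω)) *
        condDistrib X (fun ω => g (X ω)) P (g (X ω)) {X ω}) := by
  have h1 := hμ.ae_le (ae_all_iff.2 fun i => hg.ae_rnDeriv_eq_on_piece hgm hX hμ hν i)
  filter_upwards [ae_of_ae_map hX.aemeasurable h1, hmem,
    ae_of_ae_map (hgm.comp hX).aemeasurable (hg.ae_condDistrib_mem_fiber hgm hX hmem)]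
    with ω h hω hfib
  obtain ⟨i, hi⟩ := hg.exists_mem_piece hω
  rw [h i hi]
  congr 2
  -- The conditional law is carried by the fibre through `X ω`, which meets the piece containing `X
  -- ω` only at that point.
  refine measure_congr ?_
  filter_upwards [hfib] with x hx
  refine propext ⟨fun hxi => hg.injOn i hxi hi hx.2, fun hxi => ?_⟩
  rw [show x = X ω from hxi]
  exact hi

lemma IsPiecewiseBijective.ae_neg_logb_condDistrib_eq [Countable ι]
    (hg : IsPiecewiseBijective (P.map X) 𝒳 piece g J) (hgm : Measurable g) (hX : Measurable X)
    (hmem : ∀ᵐ ω ∂P, X ω ∈ 𝒳)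
    (hμ : P.map X ≪ volume) (hν : (P.map fun ω => g (X ω)) ≪ volume) :
    ∀ᵐ ω ∂P, condDistrib X (fun ω => g (X ω)) P (g (X ω)) {X ω} ≠ 0 ∧
      -Real.logb 2 (condDistrib X (fun ω => g (X ω)) P (g (X ω)) {X ω}).toReal =
        -Real.logb 2 ((P.map X).rnDeriv volume (X ω)).toReal +
          Real.logb 2 ((P.map fun ω => g (X ω)).rnDeriv volume (g (X ω))).toReal +
            Real.logb 2 |(J (X ω)).det| := by
  have hY : Measurable fun ω => g (X ω) := hgm.comp hX
  have : IsProbabilityMeasure (P.map X) := Measure.isProbabilityMeasure_map hX.aemeasurable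
  have : IsProbabilityMeasure (P.map fun ω => g (X ω)) :=
    Measure.isProbabilityMeasure_map hY.aemeasurable
  filter_upwards [hg.ae_rnDeriv_eq hgm hX hmem hμ hν,
    ae_of_ae_map hX.aemeasurable (Measure.rnDeriv_pos hμ :
      ∀ᵐ x ∂(P.map X), 0 < (P.map X).rnDeriv volume x),
    ae_of_ae_map hY.aemeasurable (hν.ae_le
      (Measure.rnDeriv_ne_top (P.map fun ω => g (X ω)) volume))] with ω h hpos hfin
  -- The density of `X` is almost surely positive at `X`, so no factor of the product vanishes and
  -- its logarithm splits.
  have hne := hpos.ne'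
  rw [h, mul_ne_zero_iff, mul_ne_zero_iff] at hne
  obtain ⟨hd, hf, hk⟩ := hne
  refine ⟨hk, ?_⟩
  rw [h, ENNReal.toReal_mul, ENNReal.toReal_mul, ENNReal.toReal_ofReal (abs_nonneg _),
    Real.logb_mul, Real.logb_mul]
  · ring
  · exact ENNReal.toReal_ne_zero.2 ⟨hf, hfin⟩
  · exact ENNReal.toReal_ne_zero.2 ⟨hk, measure_ne_top _ _⟩
  · exact fun h0 => hd (by rw [h0, ENNReal.ofReal_zero])
  · exact mul_ne_zero (ENNReal.toReal_ne_zero.2 ⟨hf, hfin⟩)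
      (ENNReal.toReal_ne_zero.2 ⟨hk, measure_ne_top _ _⟩)

end PiecewiseBijective

/-! ### Arithmetic of extended integrals. -/

section ExtIntegral

/-- If all `pᵢ` are finite, `h` forces all `mᵢ` to be finite too. So in both cases only finite
quantities are subtracted, and the total is infinite exactly when some `pᵢ` is. -/
lemma ereal_coe_eq_sub_add_sub_add_sub {d p₁ p₂ p₃ m₁ m₂ m₃ : ℝ≥0∞}
    (h : d + m₁ + m₂ + m₃ = p₁ + p₂ + p₃)
    (hm : (m₁ ≠ ⊤ ∧ m₂ ≠ ⊤ ∧ m₃ ≠ ⊤) ∨ (p₁ ≠ ⊤ ∧ p₂ ≠ ⊤ ∧ p₃ ≠ ⊤)) :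
    (d : EReal) = ((p₁ : EReal) - m₁) + (p₂ - m₂) + (p₃ - m₃) := by
  have hm' : m₁ ≠ ⊤ ∧ m₂ ≠ ⊤ ∧ m₃ ≠ ⊤ := by
    refine hm.elim id fun hp => ?_
    have hfin : d + m₁ + m₂ + m₃ ≠ ⊤ := by
      rw [h]
      exact ENNReal.add_ne_top.2 ⟨ENNReal.add_ne_top.2 ⟨hp.1, hp.2.1⟩, hp.2.2⟩
    simp only [ENNReal.add_ne_top] at hfin
    exact ⟨hfin.1.1.2, hfin.1.2, hfin.2⟩
  obtain ⟨h1, h2, h3⟩ := hm'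
  lift m₁ to NNReal using h1
  lift m₂ to NNReal using h2
  lift m₃ to NNReal using h3
  have hr : ∀ r : NNReal, ((r : ℝ≥0∞) : EReal) = ((r : ℝ) : EReal) := fun r => rfl
  by_cases hp : p₁ ≠ ⊤ ∧ p₂ ≠ ⊤ ∧ p₃ ≠ ⊤
  · obtain ⟨h1, h2, h3⟩ := hp
    lift p₁ to NNReal using h1
    lift p₂ to NNReal using h2
    lift p₃ to NNReal using h3
    have hd : d ≠ ⊤ := fun hd => by simp [hd, ← ENNReal.coe_add] at h
    lift d to NNReal using hd
    have h' : (d : ℝ) + m₁ + m₂ + m₃ = p₁ + p₂ + p₃ := by exact_mod_cast h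
    simp only [hr, ← EReal.coe_sub, ← EReal.coe_add]
    congr 1
    linarith
  · have hd : d = ⊤ := by
      by_contra hd
      lift d to NNReal using hd
      refine hp ?_
      have hfin : p₁ + p₂ + p₃ ≠ ⊤ := by
        rw [← h]
        simp [← ENNReal.coe_add]
      simp only [ENNReal.add_ne_top] at hfin
      exact ⟨hfin.1.1, hfin.1.2, hfin.2⟩
    subst hd
    induction p₁ using ENNReal.recTopCoe <;> induction p₂ using ENNReal.recTopCoe <;>
      induction p₃ using ENNReal.recTopCoe <;>
      simp_all [← EReal.coe_sub, ← EReal.coe_add]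

variable {α : Type*} [MeasurableSpace α] {μ : Measure α}

lemma ofReal_add_ofReal_neg {a b c d : ℝ} (h : d = a + b + c) (hd : 0 ≤ d) :
    ENNReal.ofReal d + ENNReal.ofReal (-a) + ENNReal.ofReal (-b) + ENNReal.ofReal (-c) =
      ENNReal.ofReal a + ENNReal.ofReal b + ENNReal.ofReal c := by
  rw [← ENNReal.toReal_eq_toReal_iff' (by simp) (by simp)]
  have h1 := max_zero_sub_max_neg_zero_eq_self a
  have h2 := max_zero_sub_max_neg_zero_eq_self b
  have h3 := max_zero_sub_max_neg_zero_eq_self c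
  simp only [ENNReal.toReal_add, ne_eq, ENNReal.add_eq_top, ENNReal.ofReal_ne_top, or_self,
    not_false_eq_true, ENNReal.toReal_ofReal', max_eq_left hd]
  linarith

/-- Additivity of the extended integral, for a nonnegative sum of three functions. -/
lemma coe_lintegral_eq_extIntegral_add {a b c d : α → ℝ} (ha : AEMeasurable a μ)
    (hb : AEMeasurable b μ) (hc : AEMeasurable c μ) (h : ∀ᵐ x ∂μ, d x = a x + b x + c x)
    (hd : ∀ᵐ x ∂μ, 0 ≤ d x)
    (hfin : ((∫⁻ x, ENNReal.ofReal (-a x) ∂μ) ≠ ⊤ ∧ (∫⁻ x, ENNReal.ofReal (-b x) ∂μ) ≠ ⊤ ∧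
        (∫⁻ x, ENNReal.ofReal (-c x) ∂μ) ≠ ⊤) ∨
      ((∫⁻ x, ENNReal.ofReal (a x) ∂μ) ≠ ⊤ ∧ (∫⁻ x, ENNReal.ofReal (b x) ∂μ) ≠ ⊤ ∧
        (∫⁻ x, ENNReal.ofReal (c x) ∂μ) ≠ ⊤)) :
    ((∫⁻ x, ENNReal.ofReal (d x) ∂μ : ℝ≥0∞) : EReal) =
      extIntegral a μ + extIntegral b μ + extIntegral c μ := by
  refine ereal_coe_eq_sub_add_sub_add_sub ?_ hfin
  have hn : ∀ {f : α → ℝ}, AEMeasurable f μ → AEMeasurable (fun x => ENNReal.ofReal (-f x)) μ :=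
    fun hf => hf.neg.ennreal_ofReal
  rw [← lintegral_add_right' _ (hn ha), ← lintegral_add_right' _ (hn hb),
    ← lintegral_add_right' _ (hn hc), ← lintegral_add_right' _ hb.ennreal_ofReal,
    ← lintegral_add_right' _ hc.ennreal_ofReal]
  refine lintegral_congr_ae ?_
  filter_upwards [h, hd] with x hx hx0
  exact ofReal_add_ofReal_neg hx hx0

lemma QuasiIntegrable.lintegral_neg_ne_top {f : α → ℝ} (hf : QuasiIntegrable f μ)
    (h : extIntegral f μ ≠ ⊥) : (∫⁻ x, ENNReal.ofReal (-f x) ∂μ) ≠ ⊤ := by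
  refine hf.2.elim (fun hp hn => h ?_) id
  rw [extIntegral, hn, EReal.coe_ennreal_top, EReal.sub_top]

lemma QuasiIntegrable.lintegral_ne_top {f : α → ℝ} (hf : QuasiIntegrable f μ)
    (h : extIntegral f μ ≠ ⊤) : (∫⁻ x, ENNReal.ofReal (f x) ∂μ) ≠ ⊤ := by
  refine hf.2.elim id fun hn hp => h ?_
  lift (∫⁻ x, ENNReal.ofReal (-f x) ∂μ) to NNReal using hn with r hr
  rw [extIntegral, hp, ← hr]
  exact EReal.top_sub_coe r

/-- Quasi-integrability is essential: in `EReal`, `⊤ - ⊤ = ⊥`, which is not its own negative. -/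
lemma QuasiIntegrable.extIntegral_neg {f : α → ℝ} (hf : QuasiIntegrable f μ) :
    extIntegral (fun x => -f x) μ = -extIntegral f μ := by
  simp only [extIntegral, neg_neg]
  rw [EReal.neg_sub]
  · rw [add_comm, sub_eq_add_neg]
  · simp
  · refine hf.2.symm.elim (fun h => ?_) (fun h => ?_)
    all_goals simp [h]

end ExtIntegral

/-! ### Differential entropy as an expectation. -/

section DiffEntropy

variable {N : ℕ} {Ω : Type*} [MeasurableSpace Ω] {P : Measure Ω} [IsProbabilityMeasure P]
  {Z : Ω → RSpace N}

/-- This moves Lebesgue integrals to `Ω`, where both entropies and the Jacobian term can be added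
under one measure. -/
lemma lintegral_density_mul (hZ : Measurable Z) (hac : P.map Z ≪ volume) {φ : RSpace N → ℝ}
    (hφ : Measurable φ) :
    ∫⁻ x, ENNReal.ofReal (((P.map Z).rnDeriv volume x).toReal * φ x) =
      ∫⁻ ω, ENNReal.ofReal (φ (Z ω)) ∂P := by
  have : IsProbabilityMeasure (P.map Z) := Measure.isProbabilityMeasure_map hZ.aemeasurable
  have e : ∫⁻ ω, ENNReal.ofReal (φ (Z ω)) ∂P = ∫⁻ x, ENNReal.ofReal (φ x) ∂(P.map Z) := by
    rw [lintegral_map hφ.ennreal_ofReal hZ]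
  rw [e, ← lintegral_rnDeriv_mul hac hφ.ennreal_ofReal.aemeasurable]
  refine lintegral_congr_ae ?_
  filter_upwards [(P.map Z).rnDeriv_ne_top volume] with x hx
  rw [ENNReal.ofReal_mul ENNReal.toReal_nonneg, ENNReal.ofReal_toReal hx]

lemma measurable_logb_rnDeriv (μ : Measure (RSpace N)) :
    Measurable fun x => Real.logb 2 (μ.rnDeriv volume x).toReal :=
  (Real.measurable_log.comp (Measure.measurable_rnDeriv _ _).ennreal_toReal).div_const _

lemma lintegral_diffEntropyIntegrand (hZ : Measurable Z) (hac : P.map Z ≪ volume) :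
    ∫⁻ x, ENNReal.ofReal (diffEntropyIntegrand (P.map Z) x) =
      ∫⁻ ω, ENNReal.ofReal (-Real.logb 2 ((P.map Z).rnDeriv volume (Z ω)).toReal) ∂P := by
  rw [← lintegral_density_mul (φ := fun x => -Real.logb 2 ((P.map Z).rnDeriv volume x).toReal)
    hZ hac (measurable_logb_rnDeriv (P.map Z)).neg]
  simp only [diffEntropyIntegrand, mul_neg]

lemma lintegral_neg_diffEntropyIntegrand (hZ : Measurable Z) (hac : P.map Z ≪ volume) :
    ∫⁻ x, ENNReal.ofReal (-diffEntropyIntegrand (P.map Z) x) =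
      ∫⁻ ω, ENNReal.ofReal (Real.logb 2 ((P.map Z).rnDeriv volume (Z ω)).toReal) ∂P := by
  rw [← lintegral_density_mul hZ hac (measurable_logb_rnDeriv (P.map Z))]
  simp only [diffEntropyIntegrand, neg_neg]

lemma diffEntropy_eq_extIntegral (hZ : Measurable Z) (hac : P.map Z ≪ volume) :
    diffEntropy (P.map Z) =
      extIntegral (fun ω => -Real.logb 2 ((P.map Z).rnDeriv volume (Z ω)).toReal) P := by
  rw [diffEntropy, extIntegral, extIntegral, lintegral_diffEntropyIntegrand hZ hac,
    lintegral_neg_diffEntropyIntegrand hZ hac]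
  simp only [neg_neg]

lemma QuasiIntegrable.of_diffEntropyIntegrand (hZ : Measurable Z) (hac : P.map Z ≪ volume)
    (h : QuasiIntegrable (diffEntropyIntegrand (P.map Z)) volume) :
    QuasiIntegrable (fun ω => -Real.logb 2 ((P.map Z).rnDeriv volume (Z ω)).toReal) P := by
  refine ⟨((measurable_logb_rnDeriv _).comp hZ).neg.aemeasurable, ?_⟩
  have h2 := h.2
  rw [lintegral_diffEntropyIntegrand hZ hac, lintegral_neg_diffEntropyIntegrand hZ hac] at h2
  simpa only [neg_neg] using h2

end DiffEntropy

/-! ### Information loss. -/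

/-- The information loss of a measurable piecewise bijective function. -/
theorem IsPiecewiseBijective.informationLoss {N : ℕ} {Ω : Type*} [MeasurableSpace Ω]
    {P : Measure Ω} [IsProbabilityMeasure P] {ι : Type*} [Countable ι]
    {𝒳 : Set (RSpace N)} {piece : ι → Set (RSpace N)}
    {g : RSpace N → RSpace N} {J : RSpace N → RSpace N →L[ℝ] RSpace N}
    {X : Ω → RSpace N} (hX : Measurable X) (hmem : ∀ᵐ ω ∂P, X ω ∈ 𝒳)
    (hac : P.map X ≪ volume) (hg : IsPiecewiseBijective (P.map X) 𝒳 piece g J)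
    (hgm : Measurable g) (hacY : (P.map fun ω => g (X ω)) ≪ volume)
    (hqX : QuasiIntegrable (diffEntropyIntegrand (P.map X)) volume)
    (hqY : QuasiIntegrable (diffEntropyIntegrand (P.map fun ω => g (X ω))) volume)
    (hqJ : QuasiIntegrable (fun ω => Real.logb 2 |(J (X ω)).det|) P)
    (hsum : (diffEntropy (P.map X) ≠ ⊥ ∧ diffEntropy (P.map fun ω => g (X ω)) ≠ ⊤ ∧
          extIntegral (fun ω => Real.logb 2 |(J (X ω)).det|) P ≠ ⊥) ∨
        (diffEntropy (P.map X) ≠ ⊤ ∧ diffEntropy (P.map fun ω => g (X ω)) ≠ ⊥ ∧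
          extIntegral (fun ω => Real.logb 2 |(J (X ω)).det|) P ≠ ⊤)) :
    (condEntropy X (fun ω => g (X ω)) P : EReal) =
        diffEntropy (P.map X) - diffEntropy (P.map fun ω => g (X ω)) +
          extIntegral (fun ω => Real.logb 2 |(J (X ω)).det|) P ∧
      ((∀ n : ℕ, mutualInfo (fun ω => quantize n (X ω)) X P ≠ ⊤) →
        Tendsto (fun n : ℕ => (mutualInfo (fun ω => quantize n (X ω)) X P : EReal) -
            (mutualInfo (fun ω => quantize n (X ω)) (fun ω => g (X ω)) P : EReal))
          atTop (𝓝 (condEntropy X (fun ω => g (X ω)) P : EReal))) := by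
  have hY : Measurable fun ω => g (X ω) := hgm.comp hX
  have hlog := hg.ae_neg_logb_condDistrib_eq hgm hX hmem hac hacY
  have hcond : condEntropy X (fun ω => g (X ω)) P = ∫⁻ ω, ENNReal.ofReal
      (-Real.logb 2 (condDistrib X (fun ω => g (X ω)) P (g (X ω)) {X ω}).toReal) ∂P := by
    refine condEntropy_eq_lintegral hX hY ?_
    filter_upwards [hg.ae_condDistrib_mem_fiber hgm hX hmem] with y hy
    exact ⟨_, hg.countable_fiber y, hy⟩
  have hqX' := hqX.of_diffEntropyIntegrand hX hac
  have hqY' := hqY.of_diffEntropyIntegrand hY hacY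
  constructor
  -- `-h(Y)` becomes the extended integral of `log f_Y(Y)`, so that the right-hand side is a sum of
  -- three extended integrals.
  · have hneg := hqY'.extIntegral_neg
    simp only [neg_neg] at hneg
    rw [hcond, sub_eq_add_neg]
    rw [diffEntropy_eq_extIntegral hX hac, diffEntropy_eq_extIntegral hY hacY] at hsum ⊢
    rw [← hneg]
    refine coe_lintegral_eq_extIntegral_add hqX'.1
      ((measurable_logb_rnDeriv _).comp hY).aemeasurable hqJ.1
      (hlog.mono fun ω h => h.2) (ae_of_all _ fun ω => ?_) ?_
    · refine neg_nonneg.2 (div_nonpos_of_nonpos_of_nonneg (Real.log_nonpos ENNReal.toReal_nonneg ?_)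
        (Real.log_pos one_lt_two).le)
      exact ENNReal.toReal_le_of_le_ofReal zero_le_one (by simpa using prob_le_one)
    · refine hsum.imp (fun h => ⟨hqX'.lintegral_neg_ne_top h.1, hqY'.lintegral_ne_top h.2.1,
        hqJ.lintegral_neg_ne_top h.2.2⟩) fun h => ⟨hqX'.lintegral_ne_top h.1, ?_,
        hqJ.lintegral_ne_top h.2.2⟩
      simpa only [neg_neg] using hqY'.lintegral_neg_ne_top h.2.1
  · intro hfin
    rw [hcond]
    simp_rw [fun n => mutualInfo_sub_mutualInfo hX hY n (hfin n)]
    exact (continuous_coe_ennreal_ereal.tendsto _).comp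
      (tendsto_lintegral_quantize hX hY (hlog.mono fun ω h => h.1))

theorem proposition4 {N : ℕ} {Ω : Type*} [MeasurableSpace Ω] (P : Measure Ω)
    [IsProbabilityMeasure P] {ι : Type*} [Countable ι]
    (𝒳 : Set (RSpace N)) (piece : ι → Set (RSpace N))
    (g : RSpace N → RSpace N) (J : RSpace N → RSpace N →L[ℝ] RSpace N)
    (X Y : Ω → RSpace N) (hX : Measurable X)
    (hX_mem : ∀ᵐ ω ∂P, X ω ∈ 𝒳)
    (hX_ac : P.map X ≪ volume)
    (hg : IsPiecewiseBijective (P.map X) 𝒳 piece g J)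
    (hY : ∀ ω, Y ω = g (X ω)) :
    P.map Y ≪ volume ∧
    -- if the three terms of the right-hand side exist in `[-∞, ∞]` ...
    (QuasiIntegrable (diffEntropyIntegrand (P.map X)) volume →
      QuasiIntegrable (diffEntropyIntegrand (P.map Y)) volume →
      QuasiIntegrable (fun ω => Real.logb 2 |(J (X ω)).det|) P →
      -- ... and their sum is not of the form `∞ - ∞`
      ((diffEntropy (P.map X) ≠ ⊥ ∧ diffEntropy (P.map Y) ≠ ⊤ ∧
          extIntegral (fun ω => Real.logb 2 |(J (X ω)).det|) P ≠ ⊥) ∨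
        (diffEntropy (P.map X) ≠ ⊤ ∧ diffEntropy (P.map Y) ≠ ⊥ ∧
          extIntegral (fun ω => Real.logb 2 |(J (X ω)).det|) P ≠ ⊤)) →
      (condEntropy X Y P : EReal) =
        diffEntropy (P.map X) - diffEntropy (P.map Y) +
          extIntegral (fun ω => Real.logb 2 |(J (X ω)).det|) P ∧
      ((∀ n : ℕ, mutualInfo (fun ω => quantize n (X ω)) X P ≠ ⊤) →
        Tendsto
          (fun n : ℕ => (mutualInfo (fun ω => quantize n (X ω)) X P : EReal) -
            (mutualInfo (fun ω => quantize n (X ω)) Y P : EReal))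
          atTop
          (𝓝 (diffEntropy (P.map X) - diffEntropy (P.map Y) +
            extIntegral (fun ω => Real.logb 2 |(J (X ω)).det|) P)))) := by
  -- `g` is not assumed measurable off `𝒳`. Since `X` is almost surely in `𝒳`, a Borel version `g'`
  -- leaves the law of `Y`, the conditional entropy and the mutual informations unchanged.
  obtain ⟨g', hg'm, hg'⟩ := hg.exists_measurable_eqOn
  have hpb := hg.congr hg'
  have hYY : Y =ᵐ[P] fun ω => g' (X ω) := by
    filter_upwards [hX_mem] with ω hω
    rw [hY, hg' hω]
  have hmap : P.map Y = P.map fun ω => g' (X ω) := Measure.map_congr hYY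
  have hcond : condEntropy X Y P = condEntropy X (fun ω => g' (X ω)) P := by
    rw [condEntropy, condEntropy, hmap, condDistrib_congr_right hYY]
  have hinfo : ∀ n, mutualInfo (fun ω => quantize n (X ω)) Y P =
      mutualInfo (fun ω => quantize n (X ω)) (fun ω => g' (X ω)) P := fun n => by
    have : P.map (fun ω => (quantize n (X ω), Y ω)) =
        P.map fun ω => (quantize n (X ω), g' (X ω)) :=
      Measure.map_congr (hYY.mono fun ω h => by simp only [h])
    rw [mutualInfo, mutualInfo, hmap, this]
  have hac : (P.map fun ω => g' (X ω)) ≪ volume := by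
    have hmem : ∀ᵐ x ∂(P.map X), x ∈ 𝒳 := (ae_map_iff hX.aemeasurable hg.measurableSet).2 hX_mem
    have := hpb.map_absolutelyContinuous hg'm hX_ac hmem
    rwa [Measure.map_map hg'm hX] at this
  simp only [hmap, hcond, hinfo]
  refine ⟨hac, fun hqX hqY hqJ hsum => ?_⟩
  obtain ⟨h1, h2⟩ := hpb.informationLoss hX hX_mem hX_ac hg'm hac hqX hqY hqJ hsum
  exact ⟨h1, h1 ▸ h2⟩
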